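/- Let $N,m\ge 1$ be integers and let $p,q>0$ be real numbers such that $p+q\ge 2$ or $p\ge 1$. Let $\Psi:(0,\infty)\to(0,\infty)$ be a non-increasing function such that $x\mapsto\Psi(|x|)$ belongs to $C(\mathbb R^N\setminus\{0\})\cap L^1_{loc}(\mathbb R^N)$ and $\lim_{r\to\infty} r^N\Psi(r)=\infty$. Let $u\in C^{2m}(\mathbb R^N)$, $u\ge 0$, satisfy $$\int_{|y|>1}u(y)^p\,\Psi\Big(\frac{|y|}{2}\Big)\,dy<\infty$$ and, for every $x\in\mathbb R^N$, $$(-\Delta)^m u(x)\ \ge\ \Big(\int_{\mathbb R^N}u(y)^p\,\Psi(|y-x|)\,dy\Big)\,u(x)^q .$$ Then $u$ is poly-superharmonic: for every integer $j$ with $1\le j\le m$ we have $(-\Delta)^j u\ge 0$ in $\mathbb R^N$. -/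

import Mathlib

open MeasureTheory Filter

noncomputable section

/-- The polyharmonic operator `(-Δ)^j`: the `j`-fold iterate of `f ↦ -Δ f`, where `Δ` is Mathlib's
Laplacian on the Euclidean space `ℝ^N`. -/
def polyLaplacian {N : ℕ} (j : ℕ) (u : EuclideanSpace ℝ (Fin N) → ℝ) :
    EuclideanSpace ℝ (Fin N) → ℝ :=
  (fun f : EuclideanSpace ℝ (Fin N) → ℝ => -(Laplacian.laplacian f))^[j] u

/-- The standing assumptions on the radial profile `Ψ` of the kernel `x ↦ Ψ(|x|)` on `ℝ^N`.
The value of `Ψ` outside `(0, ∞)` is irrelevant. -/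
structure IsAdmissibleKernel (N : ℕ) (Ψ : ℝ → ℝ) : Prop where
  pos : ∀ r : ℝ, 0 < r → 0 < Ψ r
  continuousOn : ContinuousOn (fun x : EuclideanSpace ℝ (Fin N) => Ψ ‖x‖) {0}ᶜ
  locallyIntegrable : LocallyIntegrable (fun x : EuclideanSpace ℝ (Fin N) => Ψ ‖x‖) volume
  antitoneOn : AntitoneOn Ψ (Set.Ioi 0)
  tendsto_atTop : Tendsto (fun r : ℝ => r ^ N * Ψ r) atTop atTop

/-- The convolution `(Ψ(|·|) * u^p)(x) = ∫ u(y)^p Ψ(|y - x|) dy`. -/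
def convPow {N : ℕ} (Ψ : ℝ → ℝ) (p : ℝ) (u : EuclideanSpace ℝ (Fin N) → ℝ)
    (x : EuclideanSpace ℝ (Fin N)) : ℝ :=
  ∫ y, u y ^ p * Ψ ‖y - x‖

/-- `u` is a non-negative solution of `(-Δ)^m u ≥ (Ψ(|·|) * u^p) u^q` in `ℝ^N`. For an admissible
kernel `Ψ`, the condition `tail_integrable` makes the integrand of the convolution integrable for
every `x`: for `|y| > 2|x|` one has `Ψ(|y - x|) ≤ Ψ(|y| / 2)`, and on bounded sets `u` is bounded
and the kernel is integrable. -/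
structure IsNonnegSolution {N : ℕ} (m : ℕ) (Ψ : ℝ → ℝ) (p q : ℝ)
    (u : EuclideanSpace ℝ (Fin N) → ℝ) : Prop where
  contDiff : ContDiff ℝ ((2 * m : ℕ) : WithTop ℕ∞) u
  nonneg : ∀ x, 0 ≤ u x
  tail_integrable : IntegrableOn (fun y => u y ^ p * Ψ (‖y‖ / 2)) {y | 1 < ‖y‖} volume
  ineq : ∀ x, convPow Ψ p u x * u x ^ q ≤ polyLaplacian m u x

end

/-! The proof descends in the order. The top power of `-Δ` is non-negative because the right-hand
side is. Suppose `(-Δ)^(k+1) u ≥ 0` but `(-Δ)^k u` is negative at `x₀`, with `k ≥ 1`. Then `(-Δ)^k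
u` is superharmonic, so its weighted averages around `x₀` stay below a negative constant at every
scale. Moving `(-Δ)^k` onto the weight shows that the mass of `u ≥ 0` on balls of radius `R` is at
least of order `R ^ (N + 2 * k)` (`exists_le_setIntegral_ball_of_polyLaplacian_neg`). In particular
the mean of `u` on large balls exceeds `1`.

If `p ≥ 1`, then `∫ u ^ p ≥ ∫ u` on such balls, and `R ^ N * Ψ R → ∞` contradicts the finite tail
integral.

If `p + q ≥ 2`, Cauchy–Schwarz bounds the mass of `(-Δ)^m u` on a ball below by a multiple of the
squared mass of `u` (`IsNonnegSolution.mul_sq_setIntegral_le`), while testing with cutoffs bounds it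
above by the mass of `u` on a larger ball (`exists_setIntegral_polyLaplacian_le`). Iterating between
radii `R` and `2R` forces the mass on the ball of radius `2R` to be infinite. -/

section

open Topology

/-! ### Iterated Laplacian: regularity, support, scaling -/

theorem polyLaplacian_zero {N : ℕ} (u : EuclideanSpace ℝ (Fin N) → ℝ) :
    polyLaplacian 0 u = u := rfl

theorem polyLaplacian_succ {N : ℕ} (j : ℕ) (u : EuclideanSpace ℝ (Fin N) → ℝ) :
    polyLaplacian (j + 1) u = -(Laplacian.laplacian (polyLaplacian j u)) :=
  Function.iterate_succ_apply' _ _ _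

theorem ContDiff.laplacian {N : ℕ} {n : ℕ} {f : EuclideanSpace ℝ (Fin N) → ℝ}
    (hf : ContDiff ℝ ((n + 2 : ℕ) : WithTop ℕ∞) f) :
    ContDiff ℝ (n : WithTop ℕ∞) (Laplacian.laplacian f) := by
  rw [InnerProductSpace.laplacian_eq_iteratedFDeriv_stdOrthonormalBasis]
  refine ContDiff.sum fun i _ => ?_
  have h : ContDiff ℝ (n : WithTop ℕ∞) (iteratedFDeriv ℝ 2 f) :=
    hf.iteratedFDeriv_right (by norm_cast)
  exact (ContinuousMultilinearMap.apply ℝ _ ℝ _).contDiff.comp h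

theorem ContDiff.polyLaplacian {N : ℕ} {n j : ℕ} {f : EuclideanSpace ℝ (Fin N) → ℝ}
    (hf : ContDiff ℝ ((n + 2 * j : ℕ) : WithTop ℕ∞) f) :
    ContDiff ℝ (n : WithTop ℕ∞) (polyLaplacian j f) := by
  induction j generalizing n with
  | zero => simpa [polyLaplacian_zero] using hf
  | succ j ih =>
    rw [polyLaplacian_succ]
    exact (ContDiff.laplacian (ih (n := n + 2) (by convert hf using 2; ring))).neg

theorem ContDiff.continuous_polyLaplacian {N j : ℕ} {f : EuclideanSpace ℝ (Fin N) → ℝ}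
    (hf : ContDiff ℝ ((2 * j : ℕ) : WithTop ℕ∞) f) : Continuous (_root_.polyLaplacian j f) :=
  (ContDiff.polyLaplacian (n := 0) (j := j) (by simpa using hf)).continuous

theorem HasCompactSupport.polyLaplacian {N : ℕ} (j : ℕ) {f : EuclideanSpace ℝ (Fin N) → ℝ}
    (hf : HasCompactSupport f) : HasCompactSupport (polyLaplacian j f) ∧
      tsupport (_root_.polyLaplacian j f) ⊆ tsupport f := by
  suffices h : tsupport (_root_.polyLaplacian j f) ⊆ tsupport f from
    ⟨hf.of_isClosed_subset (isClosed_tsupport _) h, h⟩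
  induction j with
  | zero => rw [polyLaplacian_zero]
  | succ j ih =>
    refine (closure_minimal ?_ (isClosed_tsupport _)).trans ih
    intro x hx
    by_contra hx'
    apply hx
    have h0 := notMem_tsupport_iff_eventuallyEq.mp hx'
    have h1 := (InnerProductSpace.laplacian_congr_nhds h0).eq_of_nhds
    rw [polyLaplacian_succ, Pi.neg_apply, h1]
    have : (Laplacian.laplacian (0 : EuclideanSpace ℝ (Fin N) → ℝ)) = 0 :=
      InnerProductSpace.laplacian_const (c := (0 : ℝ))
    simp [this]

theorem laplacian_comp_affine {N : ℕ} {f : EuclideanSpace ℝ (Fin N) → ℝ} (hf : ContDiff ℝ 2 f)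
    (x : EuclideanSpace ℝ (Fin N)) (s : ℝ) :
    Laplacian.laplacian (fun y => f (x + s • y))
      = fun y => s ^ 2 * Laplacian.laplacian f (x + s • y) := by
  have hg : ContDiff ℝ 2 (fun y => f (x + y)) := hf.comp (contDiff_const.add contDiff_id)
  have h1 : iteratedFDeriv ℝ 2 (fun y => f (x + s • y))
      = fun y => s ^ 2 • iteratedFDeriv ℝ 2 f (x + s • y) := by
    have := iteratedFDeriv_comp_const_smul (i := 2) s hg
    rw [this]
    ext1 y
    rw [iteratedFDeriv_comp_add_left]
  simp only [InnerProductSpace.laplacian_eq_iteratedFDeriv_stdOrthonormalBasis, h1]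
  ext y
  simp [Finset.mul_sum]

/-- Rescaling `f` rather than the test function keeps one fixed test function for all centres and
scales, so the constants are uniform. -/
theorem polyLaplacian_comp_affine {N j : ℕ} {f : EuclideanSpace ℝ (Fin N) → ℝ}
    (hf : ContDiff ℝ ((2 * j : ℕ) : WithTop ℕ∞) f) (x : EuclideanSpace ℝ (Fin N)) (s : ℝ) :
    polyLaplacian j (fun y => f (x + s • y))
      = fun y => s ^ (2 * j) * polyLaplacian j f (x + s • y) := by
  induction j with
  | zero => simp [polyLaplacian_zero]
  | succ j ih =>
    have h2 : ContDiff ℝ 2 (polyLaplacian j f) :=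
      ContDiff.polyLaplacian (n := 2) (by convert hf using 2; ring)
    rw [polyLaplacian_succ, ih (hf.of_le (by norm_cast; omega)), polyLaplacian_succ]
    have h3 : ContDiff ℝ 2 (fun y => polyLaplacian j f (x + s • y)) :=
      h2.comp (contDiff_const.add (contDiff_id.const_smul s))
    ext y
    have h4 := InnerProductSpace.laplacian_smul (s ^ (2 * j)) (h3.contDiffAt (x := y))
    have h5 : (fun y => s ^ (2 * j) * polyLaplacian j f (x + s • y))
      = s ^ (2 * j) • (fun y => polyLaplacian j f (x + s • y)) := rfl
    rw [Pi.neg_apply, h5, h4, laplacian_comp_affine h2]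
    simp only [smul_eq_mul, Pi.neg_apply]
    ring

/-! ### Green's identities -/

theorem laplacian_eq_sum_fderiv {N : ℕ} {f : EuclideanSpace ℝ (Fin N) → ℝ} (hf : ContDiff ℝ 2 f)
    (x : EuclideanSpace ℝ (Fin N)) :
    Laplacian.laplacian f x = ∑ i,
      fderiv ℝ (fun y => fderiv ℝ f y (EuclideanSpace.basisFun (Fin N) ℝ i)) x
        (EuclideanSpace.basisFun (Fin N) ℝ i) := by
  rw [InnerProductSpace.laplacian_eq_iteratedFDeriv_orthonormalBasis f
    (EuclideanSpace.basisFun (Fin N) ℝ)]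
  refine Finset.sum_congr rfl fun i _ => ?_
  rw [iteratedFDeriv_two_apply]
  have : DifferentiableAt ℝ (fderiv ℝ f) x :=
    (hf.fderiv_right (m := 1) (by norm_num)).differentiable (by norm_num) x
  rw [fderiv_clm_apply this (differentiableAt_const _)]
  simp

theorem integral_laplacian_mul_eq_neg_sum {N : ℕ} {f g : EuclideanSpace ℝ (Fin N) → ℝ}
    (hf : ContDiff ℝ 2 f) (hg : ContDiff ℝ 1 g) (hgs : HasCompactSupport g) :
    ∫ x, Laplacian.laplacian f x * g x
      = -∑ i, ∫ x, fderiv ℝ f x (EuclideanSpace.basisFun (Fin N) ℝ i)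
          * fderiv ℝ g x (EuclideanSpace.basisFun (Fin N) ℝ i) := by
  have hgd : ∀ v, Continuous fun x => fderiv ℝ g x v := fun v =>
    (hg.continuous_fderiv (by norm_num)).clm_apply continuous_const
  have hfd : ∀ v, ContDiff ℝ 1 fun x => fderiv ℝ f x v := fun v =>
    (hf.fderiv_right (m := 1) (by norm_num)).clm_apply contDiff_const
  have hfdd : ∀ v, Continuous fun x => fderiv ℝ (fun y => fderiv ℝ f y v) x v := fun v =>
    ((hfd v).continuous_fderiv (by norm_num)).clm_apply continuous_const
  have hgds : ∀ v, HasCompactSupport fun x => fderiv ℝ g x v := fun v => hgs.fderiv_apply ℝ v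
  have hi : ∀ v, Integrable fun x => fderiv ℝ (fun y => fderiv ℝ f y v) x v * g x := fun v =>
    ((hfdd v).mul hg.continuous).integrable_of_hasCompactSupport hgs.mul_left
  simp_rw [laplacian_eq_sum_fderiv hf, Finset.sum_mul]
  rw [integral_finsetSum _ fun i _ => hi _, ← Finset.sum_neg_distrib]
  refine Finset.sum_congr rfl fun i _ => ?_
  rw [integral_mul_fderiv_eq_neg_fderiv_mul_of_integrable (hi _), neg_neg]
  · exact ((hfd _).continuous.mul (hgd _)).integrable_of_hasCompactSupport (hgds _).mul_left
  · exact ((hfd _).continuous.mul hg.continuous).integrable_of_hasCompactSupport hgs.mul_left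
  · exact fun x _ => (hfd _).differentiable (by norm_num) x
  · exact fun x _ => hg.differentiable (by norm_num) x

theorem integral_mul_laplacian_eq_neg_sum {N : ℕ} {f g : EuclideanSpace ℝ (Fin N) → ℝ}
    (hf : ContDiff ℝ 1 f) (hg : ContDiff ℝ 2 g) (hgs : HasCompactSupport g) :
    ∫ x, f x * Laplacian.laplacian g x
      = -∑ i, ∫ x, fderiv ℝ f x (EuclideanSpace.basisFun (Fin N) ℝ i)
          * fderiv ℝ g x (EuclideanSpace.basisFun (Fin N) ℝ i) := by
  have hfd : ∀ v, Continuous fun x => fderiv ℝ f x v := fun v =>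
    (hf.continuous_fderiv (by norm_num)).clm_apply continuous_const
  have hgd : ∀ v, ContDiff ℝ 1 fun x => fderiv ℝ g x v := fun v =>
    (hg.fderiv_right (m := 1) (by norm_num)).clm_apply contDiff_const
  have hgdd : ∀ v, Continuous fun x => fderiv ℝ (fun y => fderiv ℝ g y v) x v := fun v =>
    ((hgd v).continuous_fderiv (by norm_num)).clm_apply continuous_const
  have hgds : ∀ v, HasCompactSupport fun x => fderiv ℝ g x v := fun v => hgs.fderiv_apply ℝ v
  have hi : ∀ v, Integrable fun x => f x * fderiv ℝ (fun y => fderiv ℝ g y v) x v := fun v =>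
    (hf.continuous.mul (hgdd v)).integrable_of_hasCompactSupport
      ((hgds v).fderiv_apply ℝ v).mul_left
  simp_rw [laplacian_eq_sum_fderiv hg, Finset.mul_sum]
  rw [integral_finsetSum _ fun i _ => hi _, ← Finset.sum_neg_distrib]
  refine Finset.sum_congr rfl fun i _ => ?_
  rw [integral_mul_fderiv_eq_neg_fderiv_mul_of_integrable _ (hi _)]
  · exact (hf.continuous.mul (hgd _).continuous).integrable_of_hasCompactSupport (hgds _).mul_left
  · exact fun x _ => hf.differentiable (by norm_num) x
  · exact fun x _ => (hgd _).differentiable (by norm_num) x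
  · exact ((hfd _).mul (hgd _).continuous).integrable_of_hasCompactSupport (hgds _).mul_left

/-- Both Green identities lead to the same Dirichlet form, so the outermost Laplacian on `f` can be
moved to the innermost place on `g`. -/
theorem integral_polyLaplacian_mul {N j : ℕ} {f g : EuclideanSpace ℝ (Fin N) → ℝ}
    (hf : ContDiff ℝ ((2 * j : ℕ) : WithTop ℕ∞) f) (hg : ∀ n : ℕ, ContDiff ℝ n g)
    (hgs : HasCompactSupport g) :
    ∫ x, polyLaplacian j f x * g x = ∫ x, f x * polyLaplacian j g x := by
  induction j generalizing g with
  | zero => rfl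
  | succ j ih =>
    have h2 : ContDiff ℝ 2 (polyLaplacian j f) :=
      ContDiff.polyLaplacian (n := 2) (by convert hf using 2; ring)
    have hg2 : ContDiff ℝ 2 g := hg 2
    have hg' : ∀ n : ℕ, ContDiff ℝ n (polyLaplacian 1 g) := fun n =>
      ContDiff.polyLaplacian (hg _)
    have h := ih (hf.of_le (by norm_cast; omega)) hg' (hgs.polyLaplacian 1).1
    have e : polyLaplacian (j + 1) g = polyLaplacian j (polyLaplacian 1 g) :=
      Function.iterate_succ_apply _ _ _
    rw [e, ← h, polyLaplacian_succ, polyLaplacian_succ, polyLaplacian_zero]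
    simp only [Pi.neg_apply, neg_mul, mul_neg, integral_neg]
    rw [integral_laplacian_mul_eq_neg_sum h2 (hg2.of_le (by norm_num)) hgs,
      integral_mul_laplacian_eq_neg_sum (h2.of_le (by norm_num)) hg2 hgs]

/-- Testing the rescaled function `y ↦ f (x + s y)` against a test function. -/
theorem integral_polyLaplacian_comp_affine_mul {N j : ℕ} {f g : EuclideanSpace ℝ (Fin N) → ℝ}
    (hf : ContDiff ℝ ((2 * j : ℕ) : WithTop ℕ∞) f) (hg : ∀ n : ℕ, ContDiff ℝ n g)
    (hgs : HasCompactSupport g) (x : EuclideanSpace ℝ (Fin N)) (s : ℝ) :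
    s ^ (2 * j) * ∫ y, polyLaplacian j f (x + s • y) * g y
      = ∫ y, f (x + s • y) * polyLaplacian j g y := by
  have h : ContDiff ℝ ((2 * j : ℕ) : WithTop ℕ∞) (fun y => f (x + s • y)) :=
    hf.comp (contDiff_const.add (contDiff_id.const_smul s))
  rw [← integral_polyLaplacian_mul h hg hgs, polyLaplacian_comp_affine hf, ← integral_const_mul]
  simp only [mul_assoc]

/-! ### Mean value inequality and growth of the mass -/

/-- Weighted mean value inequality for superharmonic functions; the weight `φ` is related to a
potential `Θ` by `∇Θ(y) = -φ(y) y`. -/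
theorem integral_comp_affine_mul_le_of_laplacian_nonpos {N : ℕ}
    {f Θ φ : EuclideanSpace ℝ (Fin N) → ℝ} (hf : ContDiff ℝ 2 f)
    (hΔ : ∀ x, Laplacian.laplacian f x ≤ 0) (hΘ : ContDiff ℝ 1 Θ) (hΘs : HasCompactSupport Θ)
    (hΘ0 : ∀ y, 0 ≤ Θ y) (hφ : Continuous φ) (hφs : HasCompactSupport φ)
    (hΘφ : ∀ y v, fderiv ℝ Θ y v = -(φ y * inner ℝ y v))
    (x : EuclideanSpace ℝ (Fin N)) {s : ℝ} (hs : 0 ≤ s) :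
    ∫ y, f (x + s • y) * φ y ≤ f x * ∫ y, φ y := by
  have hf' : Continuous (fderiv ℝ f) := hf.continuous_fderiv (by norm_num)
  have haff : Continuous fun z : ℝ × EuclideanSpace ℝ (Fin N) => x + z.1 • z.2 := by fun_prop
  have hcont : Continuous fun z : ℝ × EuclideanSpace ℝ (Fin N) =>
      fderiv ℝ f (x + z.1 • z.2) z.2 * φ z.2 :=
    ((hf'.comp haff).clm_apply continuous_snd).mul (hφ.comp continuous_snd)
  have hline : ∀ (y : EuclideanSpace ℝ (Fin N)) (t : ℝ),
      HasDerivAt (fun t : ℝ => f (x + t • y) * φ y) (fderiv ℝ f (x + t • y) y * φ y) t := by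
    intro y t
    have h1 : HasDerivAt (fun t : ℝ => x + t • y) y t := by
      simpa using ((hasDerivAt_id t).smul_const y).const_add x
    exact ((hf.differentiable (by norm_num) _).hasFDerivAt.comp_hasDerivAt t h1).mul_const _
  have hderiv : ∀ t : ℝ, HasDerivAt (fun t : ℝ => ∫ y, f (x + t • y) * φ y)
      (∫ y, fderiv ℝ f (x + t • y) y * φ y) t := by
    intro t
    obtain ⟨C, hC⟩ := ((isCompact_closedBall t 1).prod hφs.isCompact).exists_bound_of_continuousOn
      (f := fun z : ℝ × EuclideanSpace ℝ (Fin N) => fderiv ℝ f (x + z.1 • z.2) z.2)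
      ((hf'.comp haff).clm_apply continuous_snd).continuousOn
    refine (hasDerivAt_integral_of_dominated_loc_of_deriv_le (𝕜 := ℝ) (E := ℝ)
      (F := fun t y => f (x + t • y) * φ y)
      (F' := fun t y => fderiv ℝ f (x + t • y) y * φ y) (bound := fun y => C * ‖φ y‖)
      (Metric.closedBall_mem_nhds t one_pos) ?_ ?_ ?_ ?_ ?_ ?_).2
    · refine Eventually.of_forall fun t => Continuous.aestronglyMeasurable ?_
      exact (hf.continuous.comp (by fun_prop)).mul hφ
    · refine Continuous.integrable_of_hasCompactSupport ?_ hφs.mul_left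
      exact (hf.continuous.comp (by fun_prop)).mul hφ
    · exact (hcont.comp (Continuous.prodMk continuous_const continuous_id)).aestronglyMeasurable
    · refine Eventually.of_forall fun y t' ht' => ?_
      rw [norm_mul]
      by_cases hy : y ∈ tsupport φ
      · exact mul_le_mul_of_nonneg_right (hC (t', y) ⟨ht', hy⟩) (norm_nonneg _)
      · simp [image_eq_zero_of_notMem_tsupport hy]
    · exact (hφ.integrable_of_hasCompactSupport hφs).norm.const_mul C
    · exact Eventually.of_forall fun y t' _ => hline y t'
  -- Since `φ(y) y = -∇Θ(y)`, Green's identity turns this derivative into `t ∫ Δf(x + t y) Θ(y) dy`;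
  -- no spherical means are needed.
  have hsign : ∀ t : ℝ, 0 < t → ∫ y, fderiv ℝ f (x + t • y) y * φ y ≤ 0 := by
    intro t ht
    have hg : ContDiff ℝ 2 fun y => f (x + t • y) :=
      hf.comp (contDiff_const.add (contDiff_id.const_smul t))
    have hgd : ∀ y v, fderiv ℝ (fun y => f (x + t • y)) y v = t * fderiv ℝ f (x + t • y) v := by
      intro y v
      have h1 : HasFDerivAt (fun y : EuclideanSpace ℝ (Fin N) => x + t • y)
          (t • ContinuousLinearMap.id ℝ _) y := ((hasFDerivAt_id y).const_smul t).const_add x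
      have h2 := ((hf.differentiable (by norm_num) (x + t • y)).hasFDerivAt.comp y h1).fderiv
      have h3 : (f ∘ fun y => x + t • y) = fun y => f (x + t • y) := rfl
      rw [h3] at h2
      simp [h2]
    have key := integral_laplacian_mul_eq_neg_sum hg hΘ hΘs
    rw [laplacian_comp_affine hf] at key
    have hi : ∀ i, Integrable fun y =>
        fderiv ℝ (fun y => f (x + t • y)) y (EuclideanSpace.basisFun (Fin N) ℝ i)
          * fderiv ℝ Θ y (EuclideanSpace.basisFun (Fin N) ℝ i) := by
      intro i
      refine Continuous.integrable_of_hasCompactSupport ?_ (hΘs.fderiv_apply ℝ _).mul_left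
      exact ((hg.continuous_fderiv (by norm_num)).clm_apply continuous_const).mul
        ((hΘ.continuous_fderiv (by norm_num)).clm_apply continuous_const)
    rw [← integral_finsetSum _ fun i _ => hi i, ← integral_neg] at key
    have hpt : ∀ y, -∑ i, fderiv ℝ (fun y => f (x + t • y)) y (EuclideanSpace.basisFun (Fin N) ℝ i)
          * fderiv ℝ Θ y (EuclideanSpace.basisFun (Fin N) ℝ i)
        = t * (fderiv ℝ f (x + t • y) y * φ y) := by
      intro y
      have hy : fderiv ℝ f (x + t • y) y = ∑ i, inner ℝ y (EuclideanSpace.basisFun (Fin N) ℝ i)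
          * fderiv ℝ f (x + t • y) (EuclideanSpace.basisFun (Fin N) ℝ i) := by
        conv_lhs => rw [← (EuclideanSpace.basisFun (Fin N) ℝ).sum_repr' y]
        rw [map_sum]
        -- The expansion of `y` also hit the base point `x + t • y`; this restores it.
        rw [(EuclideanSpace.basisFun (Fin N) ℝ).sum_repr' y]
        refine Finset.sum_congr rfl fun i _ => ?_
        rw [map_smul, smul_eq_mul, real_inner_comm]
      rw [hy, Finset.sum_mul, Finset.mul_sum, ← Finset.sum_neg_distrib]
      refine Finset.sum_congr rfl fun i _ => ?_
      rw [hgd, hΘφ]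
      ring
    simp_rw [hpt] at key
    rw [integral_const_mul] at key
    have h0 : ∫ y, t ^ 2 * Laplacian.laplacian f (x + t • y) * Θ y ≤ 0 :=
      integral_nonpos fun y => mul_nonpos_of_nonpos_of_nonneg
        (mul_nonpos_of_nonneg_of_nonpos (sq_nonneg t) (hΔ _)) (hΘ0 y)
    rw [key] at h0
    exact nonpos_of_mul_nonpos_right h0 ht
  have hanti : AntitoneOn (fun t : ℝ => ∫ y, f (x + t • y) * φ y) (Set.Ici 0) := by
    refine antitoneOn_of_deriv_nonpos (convex_Ici 0)
      (fun t _ => (hderiv t).continuousAt.continuousWithinAt)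
      (fun t _ => (hderiv t).differentiableAt.differentiableWithinAt) ?_
    intro t ht
    rw [interior_Ici] at ht
    rw [(hderiv t).deriv]
    exact hsign t ht
  have := hanti (Set.mem_Ici.2 le_rfl) (Set.mem_Ici.2 hs) hs
  simpa [integral_const_mul] using this

/-- A radial potential `Θ` and a smooth weight `φ ≥ 0` of positive mass, supported in the ball of
radius `2`, with `∇Θ(y) = -φ(y) y`. -/
theorem exists_radial_weight {N : ℕ} (hN : 1 ≤ N) :
    ∃ Θ φ : EuclideanSpace ℝ (Fin N) → ℝ, ContDiff ℝ 1 Θ ∧ HasCompactSupport Θ ∧ (∀ y, 0 ≤ Θ y) ∧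
      (∀ n : ℕ, ContDiff ℝ n φ) ∧ HasCompactSupport φ ∧ tsupport φ ⊆ Metric.ball 0 2 ∧
      (∀ y, 0 ≤ φ y) ∧ 0 < ∫ y, φ y ∧ ∀ y v, fderiv ℝ Θ y v = -(φ y * inner ℝ y v) := by
  have hst : ∀ n : ℕ, ContDiff ℝ n Real.smoothTransition := fun n =>
    Real.smoothTransition.contDiff (n := n)
  have hst' : ∀ n : ℕ, ContDiff ℝ n (deriv Real.smoothTransition) := fun n =>
    ((contDiff_succ_iff_deriv (n := (n : WithTop ℕ∞))).1
      (by exact_mod_cast hst (n + 1))).2.2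
  have hsq : ∀ n : ℕ, ContDiff ℝ n fun y : EuclideanSpace ℝ (Fin N) => 2 - ‖y‖ ^ 2 := fun n =>
    contDiff_const.sub (contDiff_norm_sq ℝ)
  -- The squared norm makes the profile smooth at the origin, and the chain rule dictates `φ`.
  -- Monotonicity of the transition gives `φ ≥ 0`; both functions vanish for `‖y‖ ^ 2 > 2`.
  let Θ : EuclideanSpace ℝ (Fin N) → ℝ := fun y => Real.smoothTransition (2 - ‖y‖ ^ 2)
  let φ : EuclideanSpace ℝ (Fin N) → ℝ := fun y => 2 * deriv Real.smoothTransition (2 - ‖y‖ ^ 2)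
  have hΘ : ∀ n : ℕ, ContDiff ℝ n Θ := fun n => (hst n).comp (hsq n)
  have hφ : ∀ n : ℕ, ContDiff ℝ n φ := fun n => contDiff_const.mul ((hst' n).comp (hsq n))
  have hφ0 : ∀ y, 0 ≤ φ y := fun y =>
    mul_nonneg zero_le_two Real.smoothTransition.monotone.deriv_nonneg
  have hz : ∀ y : EuclideanSpace ℝ (Fin N), y ∉ Metric.closedBall 0 (3 / 2) → 2 - ‖y‖ ^ 2 < 0 := by
    intro y hy
    rw [mem_closedBall_zero_iff, not_le] at hy
    nlinarith
  have hΘz : ∀ y, y ∉ Metric.closedBall (0 : EuclideanSpace ℝ (Fin N)) (3 / 2) → Θ y = 0 :=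
    fun y hy => Real.smoothTransition.zero_of_nonpos (hz y hy).le
  have hφz : ∀ y, y ∉ Metric.closedBall (0 : EuclideanSpace ℝ (Fin N)) (3 / 2) → φ y = 0 := by
    intro y hy
    have h1 : Real.smoothTransition =ᶠ[𝓝 (2 - ‖y‖ ^ 2)] fun _ => 0 := by
      filter_upwards [Iio_mem_nhds (hz y hy)] with t ht
      exact Real.smoothTransition.zero_of_nonpos (le_of_lt ht)
    simp [φ, h1.deriv_eq]
  have hΘs : HasCompactSupport Θ := HasCompactSupport.intro (isCompact_closedBall _ _) hΘz
  have hφs : HasCompactSupport φ := HasCompactSupport.intro (isCompact_closedBall _ _) hφz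
  have hgrad : ∀ y v, fderiv ℝ Θ y v = -(φ y * inner ℝ y v) := by
    intro y v
    have h1 : HasFDerivAt (fun y : EuclideanSpace ℝ (Fin N) => 2 - ‖y‖ ^ 2)
        (-(2 • innerSL ℝ y)) y := (hasStrictFDerivAt_norm_sq y).hasFDerivAt.const_sub 2
    have h2 := (((hst 1).differentiable (by norm_num) (2 - ‖y‖ ^ 2)).hasDerivAt.comp_hasFDerivAt y
      h1).fderiv
    have h3 : (Real.smoothTransition ∘ fun y : EuclideanSpace ℝ (Fin N) => 2 - ‖y‖ ^ 2) = Θ := rfl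
    rw [h3] at h2
    rw [h2]
    simp [φ]
    ring
  refine ⟨Θ, φ, hΘ 1, hΘs, fun y => Real.smoothTransition.nonneg _, hφ, hφs, ?_, hφ0, ?_, hgrad⟩
  · refine (closure_minimal (fun y hy => ?_) Metric.isClosed_closedBall).trans
      (Metric.closedBall_subset_ball (by norm_num : (3 / 2 : ℝ) < 2))
    by_contra h
    exact hy (hφz y h)
  -- Without mass, `φ` and hence `∇Θ` would vanish identically, yet `Θ` is `1` at the origin and `0`
  -- at a point of norm `2`.
  · by_contra hle
    have hcont : Continuous φ := (hφ 0).continuous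
    have h1 : ∀ y, φ y = 0 := fun y => by
      by_contra hy
      exact hle (hcont.integral_pos_of_hasCompactSupport_nonneg_nonzero hφs hφ0 hy)
    have h2 : ∀ y, fderiv ℝ Θ y = 0 := fun y => by
      ext v
      simp [hgrad, h1]
    have h3 := is_const_of_fderiv_eq_zero ((hΘ 1).differentiable (by norm_num)) h2 0
      (EuclideanSpace.single ⟨0, hN⟩ 2)
    have h4 : Θ 0 = 1 := Real.smoothTransition.one_of_one_le (by norm_num)
    have h5 : Θ (EuclideanSpace.single ⟨0, hN⟩ 2) = 0 :=
      hΘz _ (by rw [mem_closedBall_zero_iff]; norm_num)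
    rw [h4, h5] at h3
    exact one_ne_zero h3

/-- If `(-Δ)^(k+1) u ≥ 0` and `(-Δ)^k u` is negative somewhere, then the integrals of `u ≥ 0`
over large balls grow at least like `R ^ (N + 2 k)`. -/
theorem exists_le_setIntegral_ball_of_polyLaplacian_neg {N k : ℕ} (hN : 1 ≤ N)
    {u : EuclideanSpace ℝ (Fin N) → ℝ} (hu : ContDiff ℝ ((2 * (k + 1) : ℕ) : WithTop ℕ∞) u)
    (hu0 : ∀ x, 0 ≤ u x) (hk : ∀ x, 0 ≤ polyLaplacian (k + 1) u x)
    {x₀ : EuclideanSpace ℝ (Fin N)} (hx₀ : polyLaplacian k u x₀ < 0) :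
    ∃ c : ℝ, 0 < c ∧ ∀ᶠ R in atTop, c * R ^ (N + 2 * k) ≤ ∫ x in Metric.closedBall 0 R, u x := by
  obtain ⟨Θ, φ, hΘ, hΘs, hΘ0, hφ, hφs, hφt, hφ0, hφI, hgrad⟩ := exists_radial_weight hN
  have h2 : ContDiff ℝ 2 (polyLaplacian k u) :=
    ContDiff.polyLaplacian (n := 2) (by convert hu using 2; ring)
  have hψc : Continuous (polyLaplacian k φ) := ContDiff.continuous_polyLaplacian (hφ _)
  obtain ⟨hψs, hψt⟩ := hφs.polyLaplacian k
  obtain ⟨C₀, hC₀⟩ := hψs.exists_bound_of_continuous hψc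
  set C := max C₀ 1
  have hC : ∀ y, |polyLaplacian k φ y| ≤ C := fun y => (hC₀ y).trans (le_max_left _ _)
  have hCpos : 0 < C := lt_of_lt_of_le one_pos (le_max_right _ _)
  -- By the mean value inequality, `(-Δ)^k u` rescaled around `x₀` has integral at most `-a` against
  -- `φ`, at every scale.
  set a := -polyLaplacian k u x₀ * ∫ y, φ y
  have ha : 0 < a := mul_pos (neg_pos.2 hx₀) hφI
  have huc : Continuous u := hu.continuous
  have main : ∀ s : ℝ, 0 < s → a / C * s ^ (2 * k) * s ^ N
      ≤ ∫ x in Metric.ball x₀ (2 * s), u x := by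
    intro s hs
    have hus : Continuous fun y => u (x₀ + s • y) := huc.comp (by fun_prop)
    have e1 := integral_polyLaplacian_comp_affine_mul (hu.of_le (by norm_cast; omega)) hφ hφs x₀ s
      (j := k)
    have e2 := integral_comp_affine_mul_le_of_laplacian_nonpos h2 (fun x => by
      have := hk x
      rw [polyLaplacian_succ] at this
      exact neg_nonneg.1 this) hΘ hΘs hΘ0 (hφ 0).continuous hφs hgrad x₀ hs.le
    have e3 : -∫ y, u (x₀ + s • y) * polyLaplacian k φ y
        ≤ C * ∫ y in Metric.ball 0 2, u (x₀ + s • y) := by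
      have hint : IntegrableOn (fun y => u (x₀ + s • y)) (Metric.ball 0 2) :=
        (hus.continuousOn.integrableOn_compact (isCompact_closedBall 0 2)).mono_set
          Metric.ball_subset_closedBall
      rw [← integral_neg, ← integral_const_mul, ← setIntegral_eq_integral_of_forall_compl_eq_zero
        (s := Metric.ball 0 2)]
      · refine setIntegral_mono_on ?_ (hint.const_mul C) measurableSet_ball fun y _ => ?_
        · exact ((hus.mul hψc).neg.integrable_of_hasCompactSupport hψs.mul_left.neg).integrableOn
        · nlinarith [neg_abs_le (polyLaplacian k φ y), hC y, hu0 (x₀ + s • y)]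
      · intro y hy
        rw [image_eq_zero_of_notMem_tsupport fun h => hy (hφt (hψt h)), mul_zero, neg_zero]
    have e4 : ∫ y in Metric.ball 0 2, u (x₀ + s • y)
        = (s ^ N)⁻¹ * ∫ x in Metric.ball x₀ (2 * s), u x := by
      have := Measure.setIntegral_comp_smul_of_pos volume (fun y => u (x₀ + y))
        (Metric.ball (0 : EuclideanSpace ℝ (Fin N)) 2) hs
      rw [this, finrank_euclideanSpace_fin, smul_eq_mul, smul_ball hs.ne', smul_zero,
        Real.norm_of_nonneg hs.le, mul_comm s 2]
      congr 1
      have hmp := measurePreserving_add_left (volume : Measure (EuclideanSpace ℝ (Fin N))) x₀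
      rw [← hmp.setIntegral_preimage_emb (measurableEmbedding_addLeft x₀) u (Metric.ball x₀ (2 * s))]
      simp
    have hsN : 0 < s ^ N := pow_pos hs N
    have e5 : a * s ^ (2 * k) ≤ C * ((s ^ N)⁻¹ * ∫ x in Metric.ball x₀ (2 * s), u x) := by
      rw [← e4]
      refine le_trans ?_ e3
      rw [← e1]
      have := mul_le_mul_of_nonneg_left e2 (pow_nonneg hs.le (2 * k))
      simp only [a]
      linarith
    calc a / C * s ^ (2 * k) * s ^ N = (a * s ^ (2 * k)) * (s ^ N / C) := by field_simp
      _ ≤ (C * ((s ^ N)⁻¹ * ∫ x in Metric.ball x₀ (2 * s), u x)) * (s ^ N / C) := by gcongr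
      _ = ∫ x in Metric.ball x₀ (2 * s), u x := by field_simp
  -- The scale is `s = R / 4`: the ball of radius `R / 2` about `x₀` lies in the ball of radius `R`
  -- about `0` once `R ≥ 2 * ‖x₀‖`.
  refine ⟨a / C * (1 / 4) ^ (N + 2 * k), by positivity, ?_⟩
  filter_upwards [eventually_gt_atTop 0, eventually_ge_atTop (2 * ‖x₀‖)] with R hR hRx
  have h := main (R / 4) (by positivity)
  have hsub : Metric.ball x₀ (2 * (R / 4)) ⊆ Metric.closedBall 0 R := by
    refine (Metric.ball_subset_ball' ?_).trans Metric.ball_subset_closedBall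
    rw [dist_zero_right]
    linarith
  have hint : IntegrableOn u (Metric.closedBall 0 R) :=
    huc.continuousOn.integrableOn_compact (isCompact_closedBall 0 R)
  refine le_trans (le_trans (le_of_eq ?_) h) (setIntegral_mono_set hint
    (Eventually.of_forall hu0) hsub.eventuallyLE)
  rw [div_eq_mul_one_div R 4]
  ring

/-! ### Local a priori estimate -/

theorem setIntegral_comp_add_right_closedBall {N : ℕ} (f : EuclideanSpace ℝ (Fin N) → ℝ)
    (v : EuclideanSpace ℝ (Fin N)) (r : ℝ) :
    ∫ z in Metric.closedBall 0 r, f (z + v) = ∫ z in Metric.closedBall v r, f z := by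
  rw [← (measurePreserving_add_right volume v).setIntegral_preimage_emb
    (measurableEmbedding_addRight v) f (Metric.closedBall v r)]
  simp

/-- The local a priori estimate: the mass of `(-Δ)^m u ≥ 0` in a ball is controlled by the mass of
`u ≥ 0` in a concentric larger ball. -/
theorem exists_setIntegral_polyLaplacian_le {N m : ℕ} {u : EuclideanSpace ℝ (Fin N) → ℝ}
    (hu : ContDiff ℝ ((2 * m : ℕ) : WithTop ℕ∞) u) (hu0 : ∀ x, 0 ≤ u x)
    (hm : ∀ x, 0 ≤ polyLaplacian m u x) :
    ∃ C : ℝ, 0 < C ∧ ∀ r h : ℝ, 0 < h →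
      h ^ (2 * m) * ∫ x in Metric.closedBall 0 r, polyLaplacian m u x
        ≤ C * ∫ x in Metric.closedBall 0 (r + 3 * h), u x := by
  let η : ContDiffBump (0 : EuclideanSpace ℝ (Fin N)) := ⟨1, 2, one_pos, one_lt_two⟩
  have hη : ∀ n : ℕ, ContDiff ℝ n η := fun n => η.contDiff
  have hηs : HasCompactSupport η := η.hasCompactSupport
  have hψc : Continuous (polyLaplacian m η) := ContDiff.continuous_polyLaplacian (hη _)
  obtain ⟨hψs, hψt⟩ := hηs.polyLaplacian m
  obtain ⟨C₀, hC₀⟩ := hψs.exists_bound_of_continuous hψc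
  set C := max C₀ 1
  have hC : ∀ y, |polyLaplacian m η y| ≤ C := fun y => (hC₀ y).trans (le_max_left _ _)
  have hCpos : 0 < C := lt_of_lt_of_le one_pos (le_max_right _ _)
  have huc : Continuous u := hu.continuous
  have hmc : Continuous (polyLaplacian m u) := ContDiff.continuous_polyLaplacian hu
  have hball : ∀ r : ℝ, IsCompact (Metric.closedBall (0 : EuclideanSpace ℝ (Fin N)) r) :=
    fun r => isCompact_closedBall 0 r
  set V : ℝ → ℝ := fun r => volume.real (Metric.closedBall (0 : EuclideanSpace ℝ (Fin N)) r)
  have hV1 : 0 < V 1 := ENNReal.toReal_pos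
    (Metric.measure_closedBall_pos _ _ one_pos).ne' (hball 1).measure_lt_top.ne
  have hV2 : 0 < V 2 := ENNReal.toReal_pos
    (Metric.measure_closedBall_pos _ _ two_pos).ne' (hball 2).measure_lt_top.ne
  have haff : ∀ h : ℝ, Continuous fun w : EuclideanSpace ℝ (Fin N) × EuclideanSpace ℝ (Fin N) =>
    w.1 + h • w.2 := fun h => by fun_prop
  have hprod : ∀ (f : EuclideanSpace ℝ (Fin N) → ℝ), Continuous f → ∀ h a b : ℝ,
      Integrable (fun w : EuclideanSpace ℝ (Fin N) × EuclideanSpace ℝ (Fin N) => f (w.1 + h • w.2))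
        ((volume.restrict (Metric.closedBall 0 a)).prod
          (volume.restrict (Metric.closedBall 0 b))) := by
    intro f hf h a b
    rw [Measure.prod_restrict]
    exact (hf.comp (haff h)).continuousOn.integrableOn_compact ((hball a).prod (hball b))
  -- The estimate at scale `h` around one centre `z`, by testing with the bump. Integrating over
  -- centres `z` then decouples `r` from `h`.
  have hloc : ∀ z (h : ℝ), 0 < h →
      h ^ (2 * m) * ∫ y in Metric.closedBall 0 1, polyLaplacian m u (z + h • y)
        ≤ C * ∫ y in Metric.closedBall 0 2, u (z + h • y) := by
    intro z h hh
    have hus : Continuous fun y => u (z + h • y) := huc.comp (by fun_prop)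
    have hms : Continuous fun y => polyLaplacian m u (z + h • y) := hmc.comp (by fun_prop)
    have e1 := integral_polyLaplacian_comp_affine_mul hu hη hηs z h
    have e2 : ∫ y in Metric.closedBall 0 1, polyLaplacian m u (z + h • y)
        ≤ ∫ y, polyLaplacian m u (z + h • y) * η y := by
      have hint : Integrable fun y => polyLaplacian m u (z + h • y) * η y :=
        (hms.mul η.continuous).integrable_of_hasCompactSupport hηs.mul_left
      calc ∫ y in Metric.closedBall 0 1, polyLaplacian m u (z + h • y)
          = ∫ y in Metric.closedBall 0 1, polyLaplacian m u (z + h • y) * η y := by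
            refine setIntegral_congr_fun measurableSet_closedBall fun y hy => ?_
            rw [η.one_of_mem_closedBall hy, mul_one]
        _ ≤ _ := setIntegral_le_integral hint
            (Eventually.of_forall fun y => mul_nonneg (hm _) η.nonneg)
    have e3 : ∫ y, u (z + h • y) * polyLaplacian m η y
        ≤ C * ∫ y in Metric.closedBall 0 2, u (z + h • y) := by
      rw [← integral_const_mul, ← setIntegral_eq_integral_of_forall_compl_eq_zero
        (s := Metric.closedBall 0 2)]
      · refine setIntegral_mono_on ?_ ((hus.continuousOn.integrableOn_compact (hball 2)).const_mul C)
          measurableSet_closedBall fun y _ => ?_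
        · exact ((hus.mul hψc).integrable_of_hasCompactSupport hψs.mul_left).integrableOn
        · nlinarith [le_abs_self (polyLaplacian m η y), hC y, hu0 (z + h • y)]
      · intro y hy
        rw [image_eq_zero_of_notMem_tsupport fun h => hy (η.tsupport_eq ▸ hψt h), mul_zero]
    calc _ ≤ h ^ (2 * m) * ∫ y, polyLaplacian m u (z + h • y) * η y := by gcongr
      _ ≤ _ := by rw [e1]; exact e3
  have hshift : ∀ (f : EuclideanSpace ℝ (Fin N) → ℝ) (h a : ℝ) y,
      ∫ z in Metric.closedBall 0 a, f (z + h • y) = ∫ z in Metric.closedBall (h • y) a, f z :=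
    fun f h a y => setIntegral_comp_add_right_closedBall f _ _
  refine ⟨C * V 2 / V 1, by positivity, fun r h hh => ?_⟩
  have hnorm : ∀ (y : EuclideanSpace ℝ (Fin N)) b, y ∈ Metric.closedBall 0 b → ‖h • y‖ ≤ h * b := by
    intro y b hy
    rw [norm_smul, Real.norm_of_nonneg hh.le]
    exact mul_le_mul_of_nonneg_left (mem_closedBall_zero_iff.1 hy) hh.le
  have hint : ∀ f : EuclideanSpace ℝ (Fin N) → ℝ, Continuous f → ∀ x a,
      IntegrableOn f (Metric.closedBall x a) := fun f hf x a =>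
    hf.continuousOn.integrableOn_compact (isCompact_closedBall x a)
  -- After Fubini, each `y` shifts the ball of radius `r + h` by `h • y`. For `‖y‖ ≤ 1` it still
  -- contains the ball of radius `r`; for `‖y‖ ≤ 2` it stays in the one of radius `r + 3 * h`.
  have lower : V 1 * ∫ x in Metric.closedBall 0 r, polyLaplacian m u x
      ≤ ∫ z in Metric.closedBall 0 (r + h), ∫ y in Metric.closedBall 0 1,
        polyLaplacian m u (z + h • y) := by
    rw [integral_integral_swap (hprod _ hmc h (r + h) 1)]
    have hi := (hprod _ hmc h (r + h) 1).integral_prod_right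
    rw [← smul_eq_mul, ← setIntegral_const]
    refine setIntegral_mono_on (hint _ continuous_const _ _) hi measurableSet_closedBall
      fun y hy => ?_
    rw [hshift]
    refine setIntegral_mono_set (hint _ hmc _ _) (Eventually.of_forall hm)
      (Metric.closedBall_subset_closedBall' ?_).eventuallyLE
    rw [dist_zero_left]
    linarith [hnorm y 1 hy]
  have upper : ∫ z in Metric.closedBall 0 (r + h), ∫ y in Metric.closedBall 0 2, u (z + h • y)
      ≤ V 2 * ∫ x in Metric.closedBall 0 (r + 3 * h), u x := by
    rw [integral_integral_swap (hprod _ huc h (r + h) 2)]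
    have hi := (hprod _ huc h (r + h) 2).integral_prod_right
    rw [← smul_eq_mul, ← setIntegral_const]
    refine setIntegral_mono_on hi (hint _ continuous_const _ _) measurableSet_closedBall
      fun y hy => ?_
    rw [hshift]
    refine setIntegral_mono_set (hint _ huc _ _) (Eventually.of_forall hu0)
      (Metric.closedBall_subset_closedBall' ?_).eventuallyLE
    rw [dist_zero_right]
    linarith [hnorm y 2 hy]
  have mid : h ^ (2 * m) * ∫ z in Metric.closedBall 0 (r + h), ∫ y in Metric.closedBall 0 1,
        polyLaplacian m u (z + h • y)
      ≤ C * ∫ z in Metric.closedBall 0 (r + h), ∫ y in Metric.closedBall 0 2, u (z + h • y) := by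
    rw [← integral_const_mul, ← integral_const_mul]
    exact setIntegral_mono_on ((hprod _ hmc h (r + h) 1).integral_prod_left.const_mul _)
      ((hprod _ huc h (r + h) 2).integral_prod_left.const_mul _) measurableSet_closedBall
      fun z _ => hloc z h hh
  have hh' : 0 < h ^ (2 * m) := by positivity
  rw [div_mul_eq_mul_div, le_div_iff₀ hV1]
  calc _ = h ^ (2 * m) * (V 1 * ∫ x in Metric.closedBall 0 r, polyLaplacian m u x) := by ring
    _ ≤ _ := mul_le_mul_of_nonneg_left lower hh'.le
    _ ≤ _ := mid
    _ ≤ C * (V 2 * ∫ x in Metric.closedBall 0 (r + 3 * h), u x) :=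
      mul_le_mul_of_nonneg_left upper hCpos.le
    _ = _ := by ring

/-! ### Integral inequalities for powers -/

/-- If `f ≥ 0` has mean at least `1` on `K`, raising it to a power `s ≥ 1` does not decrease its
integral. -/
theorem setIntegral_le_setIntegral_rpow {X : Type*} [TopologicalSpace X] [T2Space X]
    [MeasurableSpace X] [OpensMeasurableSpace X] {μ : Measure X} [IsFiniteMeasureOnCompacts μ]
    {f : X → ℝ} (hf : Continuous f) (hf0 : ∀ x, 0 ≤ f x) {s : ℝ} (hs : 1 ≤ s) {K : Set X}
    (hK : IsCompact K) (h : μ.real K ≤ ∫ x in K, f x ∂μ) :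
    ∫ x in K, f x ∂μ ≤ ∫ x in K, f x ^ s ∂μ := by
  have hfi : IntegrableOn f K μ := hf.continuousOn.integrableOn_compact hK
  have hsi : IntegrableOn (fun x => f x ^ s) K μ :=
    (hf.rpow_const fun x => Or.inr (by linarith)).continuousOn.integrableOn_compact hK
  have h1i : IntegrableOn (fun _ => (1 : ℝ)) K μ := continuousOn_const.integrableOn_compact hK
  -- Bernoulli's inequality, that is, the tangent line of `t ↦ t ^ s` at `t = 1`.
  have h1 : ∫ x in K, (1 + s * (f x - 1)) ∂μ ≤ ∫ x in K, f x ^ s ∂μ := by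
    refine setIntegral_mono_on (h1i.add ((hfi.sub h1i).const_mul s)) hsi hK.measurableSet
      fun x _ => ?_
    have := one_add_mul_self_le_rpow_one_add (s := f x - 1) (by linarith [hf0 x]) hs
    rwa [add_sub_cancel] at this
  have h2 : ∫ x in K, (1 + s * (f x - 1)) ∂μ = μ.real K + s * (∫ x in K, f x ∂μ - μ.real K) := by
    rw [integral_add (g := fun x => s * (f x - 1)) h1i ((hfi.sub h1i).const_mul s),
      integral_const_mul, integral_sub hfi h1i]
    simp
  nlinarith

/-- Cauchy–Schwarz inequality for powers of a function. -/
theorem sq_setIntegral_rpow_le {X : Type*} [TopologicalSpace X] [T2Space X]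
    [MeasurableSpace X] [OpensMeasurableSpace X] {μ : Measure X} [IsFiniteMeasureOnCompacts μ]
    {f : X → ℝ} (hf : Continuous f) (hf0 : ∀ x, 0 ≤ f x) {p q : ℝ} (hp : 0 < p) (hq : 0 < q)
    {K : Set X} (hK : IsCompact K) :
    (∫ x in K, f x ^ ((p + q) / 2) ∂μ) ^ 2 ≤ (∫ x in K, f x ^ p ∂μ) * ∫ x in K, f x ^ q ∂μ := by
  have hi : ∀ s : ℝ, 0 < s → IntegrableOn (fun x => f x ^ s) K μ := fun s hs =>
    (hf.rpow_const fun x => Or.inr hs.le).continuousOn.integrableOn_compact hK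
  have hpq : 0 < (p + q) / 2 := by linarith
  -- The quadratic is `∫ (t f ^ (p / 2) - f ^ (q / 2)) ^ 2`; its discriminant gives the claim.
  have h : ∀ t : ℝ, 0 ≤ (∫ x in K, f x ^ p ∂μ) * (t * t)
      + (-2 * ∫ x in K, f x ^ ((p + q) / 2) ∂μ) * t + ∫ x in K, f x ^ q ∂μ := by
    intro t
    have h1 : ∀ x, t * t * f x ^ p + -2 * t * f x ^ ((p + q) / 2) + f x ^ q
        = (t * f x ^ (p / 2) - f x ^ (q / 2)) ^ 2 := by
      intro x
      have e1 : f x ^ p = f x ^ (p / 2) * f x ^ (p / 2) := by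
        rw [← Real.rpow_add_of_nonneg (hf0 x) (by linarith) (by linarith), add_halves]
      have e2 : f x ^ q = f x ^ (q / 2) * f x ^ (q / 2) := by
        rw [← Real.rpow_add_of_nonneg (hf0 x) (by linarith) (by linarith), add_halves]
      have e3 : f x ^ ((p + q) / 2) = f x ^ (p / 2) * f x ^ (q / 2) := by
        rw [← Real.rpow_add_of_nonneg (hf0 x) (by linarith) (by linarith), add_div]
      rw [e1, e2, e3]
      ring
    have h2 : 0 ≤ ∫ x in K, (t * t * f x ^ p + -2 * t * f x ^ ((p + q) / 2) + f x ^ q) ∂μ :=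
      integral_nonneg fun x => (h1 x).symm ▸ sq_nonneg _
    rw [integral_add (f := fun x => t * t * f x ^ p + -2 * t * f x ^ ((p + q) / 2))
      (((hi p hp).const_mul _).add ((hi _ hpq).const_mul _)) (hi q hq),
      integral_add ((hi p hp).const_mul _) ((hi _ hpq).const_mul _), integral_const_mul,
      integral_const_mul] at h2
    linarith
  have := discrim_le_zero h
  rw [discrim] at this
  linarith

/-! ### The nonlocal term -/

/-- The value `Ψ 0` is arbitrary, so the sign is known only off `y = x`, which is a null set because
`N ≥ 1`. -/
theorem IsAdmissibleKernel.ae_nonneg {N : ℕ} (hN : 1 ≤ N) {Ψ : ℝ → ℝ}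
    (hΨ : IsAdmissibleKernel N Ψ) {p : ℝ} {u : EuclideanSpace ℝ (Fin N) → ℝ} (hu0 : ∀ x, 0 ≤ u x)
    (x : EuclideanSpace ℝ (Fin N)) : ∀ᵐ y, y ≠ x ∧ 0 ≤ u y ^ p * Ψ ‖y - x‖ := by
  have : Nonempty (Fin N) := ⟨⟨0, hN⟩⟩
  have h : ∀ᵐ y : EuclideanSpace ℝ (Fin N), y ≠ x := by
    simp [ae_iff]
  filter_upwards [h] with y hy
  exact ⟨hy, mul_nonneg (Real.rpow_nonneg (hu0 y) p)
    (hΨ.pos _ (norm_pos_iff.2 (sub_ne_zero.2 hy))).le⟩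

theorem convPow_nonneg {N : ℕ} (hN : 1 ≤ N) {Ψ : ℝ → ℝ}
    (hΨ : IsAdmissibleKernel N Ψ) {p : ℝ} {u : EuclideanSpace ℝ (Fin N) → ℝ} (hu0 : ∀ x, 0 ≤ u x)
    (x : EuclideanSpace ℝ (Fin N)) : 0 ≤ convPow Ψ p u x :=
  integral_nonneg_of_ae ((hΨ.ae_nonneg hN hu0 x).mono fun _ h => h.2)

theorem IsNonnegSolution.integrable_convPow {N m : ℕ} {Ψ : ℝ → ℝ}
    (hΨ : IsAdmissibleKernel N Ψ) {p q : ℝ} (hp : 0 < p) {u : EuclideanSpace ℝ (Fin N) → ℝ}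
    (hu : IsNonnegSolution m Ψ p q u) (x : EuclideanSpace ℝ (Fin N)) :
    Integrable fun y => u y ^ p * Ψ ‖y - x‖ := by
  have hup : Continuous fun y => u y ^ p :=
    hu.contDiff.continuous.rpow_const fun _ => Or.inr hp.le
  have hmp := measurePreserving_sub_right (volume : Measure (EuclideanSpace ℝ (Fin N))) x
  have hemb : MeasurableEmbedding fun y : EuclideanSpace ℝ (Fin N) => y - x :=
    measurableEmbedding_subRight x
  have hmeas : AEStronglyMeasurable (fun y => u y ^ p * Ψ ‖y - x‖) :=
    hup.aestronglyMeasurable.mul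
      (hΨ.locallyIntegrable.aestronglyMeasurable.comp_measurePreserving hmp)
  -- Beyond this radius the tail hypothesis applies and `‖y‖ / 2 ≤ ‖y - x‖`.
  set ρ := max 1 (2 * ‖x‖)
  rw [← integrableOn_univ, ← Set.union_compl_self (Metric.closedBall 0 ρ)]
  refine IntegrableOn.union ?_ ?_
  · have h1 : IntegrableOn (fun y => Ψ ‖y - x‖) (Metric.closedBall 0 ρ) := by
      have h2 : IntegrableOn (fun y : EuclideanSpace ℝ (Fin N) => Ψ ‖y‖)
          (Metric.closedBall (-x) ρ) :=
        hΨ.locallyIntegrable.integrableOn_isCompact (isCompact_closedBall _ _)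
      rw [← hmp.integrableOn_comp_preimage hemb] at h2
      have h3 : (fun y => y - x) ⁻¹' Metric.closedBall (-x) ρ = Metric.closedBall 0 ρ := by
        ext y
        simp [dist_eq_norm]
      rwa [h3] at h2
    exact h1.continuousOn_mul hup.continuousOn (isCompact_closedBall _ _)
  · have hsub : (Metric.closedBall (0 : EuclideanSpace ℝ (Fin N)) ρ)ᶜ ⊆ {y | 1 < ‖y‖} := by
      intro y hy
      rw [Set.mem_compl_iff, mem_closedBall_zero_iff, not_le] at hy
      exact (le_max_left _ _).trans_lt hy
    refine (hu.tail_integrable.mono_set hsub).mono' hmeas.restrict ?_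
    filter_upwards [ae_restrict_mem measurableSet_closedBall.compl] with y hy
    rw [Set.mem_compl_iff, mem_closedBall_zero_iff, not_le] at hy
    have h1 : 1 < ‖y‖ := (le_max_left _ _).trans_lt hy
    have h2 : 2 * ‖x‖ < ‖y‖ := (le_max_right _ _).trans_lt hy
    have h3 : ‖y‖ / 2 ≤ ‖y - x‖ := by linarith [norm_sub_norm_le y x]
    have h4 : 0 < ‖y‖ / 2 := by linarith
    have h5 : 0 ≤ u y ^ p := Real.rpow_nonneg (hu.nonneg y) p
    rw [Real.norm_of_nonneg (mul_nonneg h5 (hΨ.pos _ (h4.trans_le h3)).le)]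
    exact mul_le_mul_of_nonneg_left (hΨ.antitoneOn h4 (h4.trans_le h3) h3) h5

/-- Points of the ball are at most `2 * r` apart and `Ψ` is non-increasing, so the kernel there is
at least `Ψ (2 * r)`. The bound no longer depends on `x`. -/
theorem IsNonnegSolution.le_convPow {N m : ℕ} (hN : 1 ≤ N) {Ψ : ℝ → ℝ}
    (hΨ : IsAdmissibleKernel N Ψ) {p q : ℝ} (hp : 0 < p) {u : EuclideanSpace ℝ (Fin N) → ℝ}
    (hu : IsNonnegSolution m Ψ p q u) {r : ℝ} {x : EuclideanSpace ℝ (Fin N)}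
    (hx : x ∈ Metric.closedBall 0 r) :
    Ψ (2 * r) * ∫ y in Metric.closedBall 0 r, u y ^ p ≤ convPow Ψ p u x := by
  have hup : Continuous fun y => u y ^ p :=
    hu.contDiff.continuous.rpow_const fun _ => Or.inr hp.le
  have hi := hu.integrable_convPow hΨ hp x
  have hae := hΨ.ae_nonneg hN (p := p) hu.nonneg x
  refine le_trans ?_ (setIntegral_le_integral (s := Metric.closedBall 0 r) hi
    (hae.mono fun _ h => h.2))
  rw [← integral_const_mul]
  refine setIntegral_mono_ae_restrict
    ((hup.continuousOn.integrableOn_compact (isCompact_closedBall _ _)).const_mul _)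
    hi.integrableOn ?_
  filter_upwards [ae_restrict_mem measurableSet_closedBall, ae_restrict_of_ae hae] with y hy hy'
  rw [mem_closedBall_zero_iff] at hx hy
  have h1 : 0 < ‖y - x‖ := norm_pos_iff.2 (sub_ne_zero.2 hy'.1)
  have h2 : ‖y - x‖ ≤ 2 * r := (norm_sub_le y x).trans (by linarith)
  rw [mul_comm]
  exact mul_le_mul_of_nonneg_left (hΨ.antitoneOn h1 (h1.trans_le h2) h2)
    (Real.rpow_nonneg (hu.nonneg y) p)

/-- For `p + q ≥ 2` the right-hand side of the inequality is quadratically superlinear in the mass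
of `u` on balls where the mean of `u` is at least `1`. -/
theorem IsNonnegSolution.mul_sq_setIntegral_le {N m : ℕ} (hN : 1 ≤ N) {Ψ : ℝ → ℝ}
    (hΨ : IsAdmissibleKernel N Ψ) {p q : ℝ} (hp : 0 < p) (hq : 0 < q) (hpq : 2 ≤ p + q)
    {u : EuclideanSpace ℝ (Fin N) → ℝ} (hu : IsNonnegSolution m Ψ p q u) {r : ℝ} (hr : 0 < r)
    (hmean : volume.real (Metric.closedBall (0 : EuclideanSpace ℝ (Fin N)) r)
      ≤ ∫ x in Metric.closedBall 0 r, u x) :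
    Ψ (2 * r) * (∫ x in Metric.closedBall 0 r, u x) ^ 2
      ≤ ∫ x in Metric.closedBall 0 r, polyLaplacian m u x := by
  have huc := hu.contDiff.continuous
  have hK := isCompact_closedBall (0 : EuclideanSpace ℝ (Fin N)) r
  have hΨ0 : 0 < Ψ (2 * r) := hΨ.pos _ (by linarith)
  have h1 := setIntegral_le_setIntegral_rpow huc hu.nonneg (s := (p + q) / 2) (by linarith) hK hmean
  have h2 := sq_setIntegral_rpow_le (μ := volume) huc hu.nonneg hp hq hK
  have h0 : 0 ≤ ∫ x in Metric.closedBall 0 r, u x := integral_nonneg hu.nonneg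
  calc Ψ (2 * r) * (∫ x in Metric.closedBall 0 r, u x) ^ 2
      ≤ Ψ (2 * r) * ((∫ x in Metric.closedBall 0 r, u x ^ p)
          * ∫ x in Metric.closedBall 0 r, u x ^ q) := by
        refine mul_le_mul_of_nonneg_left (le_trans ?_ h2) hΨ0.le
        gcongr
    _ = ∫ x in Metric.closedBall 0 r,
          (Ψ (2 * r) * ∫ y in Metric.closedBall 0 r, u y ^ p) * u x ^ q := by
        rw [integral_const_mul]
        ring
    _ ≤ _ := by
        refine setIntegral_mono_on ?_ ?_ measurableSet_closedBall fun x hx => ?_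
        · exact ((huc.rpow_const fun _ => Or.inr hq.le).continuousOn.integrableOn_compact
            hK).const_mul _
        · exact (ContDiff.continuous_polyLaplacian hu.contDiff).continuousOn.integrableOn_compact hK
        · exact (mul_le_mul_of_nonneg_right (hu.le_convPow hN hΨ hp hx)
            (Real.rpow_nonneg (hu.nonneg x) q)).trans (hu.ineq x)

/-! ### Contradictions from fast growth -/

/-- The bound `2 * L ^ (n + 1) ≤ K * a n` propagates: its square is `2 * L ^ n` times the next
bound, so squaring beats the loss `L ^ n`. -/
theorem not_bddAbove_of_sq_le {a : ℕ → ℝ} {K L : ℝ} (hK : 0 < K) (hL : 1 < L)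
    (h0 : 2 * L ≤ K * a 0) (h : ∀ n, K * a n ^ 2 ≤ L ^ n * a (n + 1)) :
    ¬ BddAbove (Set.range a) := by
  have hLpos : 0 < L := one_pos.trans hL
  have key : ∀ n, 2 * L ^ (n + 1) ≤ K * a n := by
    intro n
    induction n with
    | zero => simpa using h0
    | succ n ih =>
      have hp : 0 < L ^ n := pow_pos hLpos n
      have h1 : (2 * L ^ (n + 1)) ^ 2 ≤ (K * a n) ^ 2 := by gcongr
      have h2 : (K * a n) ^ 2 ≤ L ^ n * (K * a (n + 1)) := by nlinarith [h n]
      have h3 : L ^ n * (2 * L ^ (n + 1 + 1)) ≤ (2 * L ^ (n + 1)) ^ 2 := by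
        have e : (2 * L ^ (n + 1)) ^ 2 = 2 * (L ^ n * (2 * L ^ (n + 1 + 1))) := by ring
        rw [e]
        have : 0 < L ^ n * (2 * L ^ (n + 1 + 1)) := by positivity
        linarith
      exact le_of_mul_le_mul_left (h3.trans (h1.trans h2)) hp
  rintro ⟨A, hA⟩
  obtain ⟨n, hn⟩ := pow_unbounded_of_one_lt (K * A) hL
  have h1 : a n ≤ A := hA ⟨n, rfl⟩
  have h2 : L ^ n ≤ 2 * L ^ (n + 1) := by
    have : 0 < L ^ n := pow_pos hLpos n
    rw [pow_succ]
    nlinarith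
  nlinarith [key n, mul_le_mul_of_nonneg_left h1 hK.le]

/-- When `p ≥ 1`, integrability of the tail rules out fast growth of the mass of `u`. -/
theorem IsNonnegSolution.false_of_growth_of_one_le {N m k : ℕ} (hk : 1 ≤ k) {Ψ : ℝ → ℝ}
    (hΨ : IsAdmissibleKernel N Ψ) {p q : ℝ} (hp : 1 ≤ p)
    {u : EuclideanSpace ℝ (Fin N) → ℝ} (hu : IsNonnegSolution m Ψ p q u) {c : ℝ} (hc : 0 < c)
    (hgrowth : ∀ᶠ R in atTop, c * R ^ (N + 2 * k) ≤ ∫ x in Metric.closedBall 0 R, u x)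
    (hmean : ∀ᶠ R in atTop, volume.real (Metric.closedBall (0 : EuclideanSpace ℝ (Fin N)) R)
      ≤ ∫ x in Metric.closedBall 0 R, u x) : False := by
  have huc := hu.contDiff.continuous
  have hup : Continuous fun y => u y ^ p := huc.rpow_const fun _ => Or.inr (by linarith)
  have hup0 : ∀ y, 0 ≤ u y ^ p := fun y => Real.rpow_nonneg (hu.nonneg y) p
  have hpi : ∀ R : ℝ, IntegrableOn (fun y => u y ^ p) (Metric.closedBall 0 R) := fun R =>
    hup.continuousOn.integrableOn_compact (isCompact_closedBall _ _)
  set D := ∫ y in Metric.closedBall 0 1, u y ^ p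
  set T := ∫ y in {y | 1 < ‖y‖}, u y ^ p * Ψ (‖y‖ / 2)
  have htend : Tendsto (fun R : ℝ => (R / 2) ^ N * Ψ (R / 2)) atTop atTop :=
    hΨ.tendsto_atTop.comp (tendsto_id.atTop_div_const two_pos)
  -- `R ≥ 1 / 2 + D / c` ensures that at least `c / 2 * R ^ N` of `∫ u ^ p` remains after removing
  -- the unit ball; the last condition makes this exceed what `T` allows.
  obtain ⟨R, hR1, hR2, hRg, hRm, hRT⟩ := ((eventually_gt_atTop 1).and
    ((eventually_ge_atTop (1 / 2 + D / c)).and (hgrowth.and (hmean.and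
      (htend.eventually_gt_atTop (T / (c / 2 * 2 ^ N))))))).exists
  have hpow := setIntegral_le_setIntegral_rpow huc hu.nonneg hp (isCompact_closedBall 0 R) hRm
  have hR0 : 0 < R := by linarith
  have hΨ0 : 0 < Ψ (R / 2) := hΨ.pos _ (by linarith)
  have hsub : Metric.closedBall (0 : EuclideanSpace ℝ (Fin N)) 1 ⊆ Metric.closedBall 0 R :=
    Metric.closedBall_subset_closedBall hR1.le
  have hdiff := setIntegral_sdiff (μ := volume) measurableSet_closedBall (hpi R) hsub
  have hsub' : Metric.closedBall (0 : EuclideanSpace ℝ (Fin N)) R \ Metric.closedBall 0 1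
      ⊆ {y | 1 < ‖y‖} := fun y hy => by
    simpa using hy.2
  have hT : Ψ (R / 2) * ∫ y in Metric.closedBall 0 R \ Metric.closedBall 0 1, u y ^ p ≤ T := by
    have hms : MeasurableSet {y : EuclideanSpace ℝ (Fin N) | 1 < ‖y‖} :=
      measurableSet_lt measurable_const measurable_norm
    refine le_trans ?_ (setIntegral_mono_set hu.tail_integrable ?_ hsub'.eventuallyLE)
    · rw [← integral_const_mul]
      refine setIntegral_mono_on (((hpi R).mono_set Set.sdiff_subset).const_mul _)
        (hu.tail_integrable.mono_set hsub')
        (measurableSet_closedBall.diff measurableSet_closedBall) fun y hy => ?_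
      have h1 : 1 < ‖y‖ := hsub' hy
      have h2 : ‖y‖ ≤ R := mem_closedBall_zero_iff.1 hy.1
      rw [mul_comm]
      refine mul_le_mul_of_nonneg_left (hΨ.antitoneOn ?_ ?_ ?_) (hup0 y)
      · exact Set.mem_Ioi.2 (by linarith)
      · exact Set.mem_Ioi.2 (by linarith)
      · linarith
    · filter_upwards [ae_restrict_mem hms] with y hy
      have hy' : 1 < ‖y‖ := hy
      exact mul_nonneg (hup0 y) (hΨ.pos _ (by linarith)).le
  rw [hdiff] at hT
  have hRN : 1 ≤ R ^ N := one_le_pow₀ hR1.le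
  have h1 : c * (R ^ N * R) ≤ c * R ^ (N + 2 * k) := by
    rw [← pow_succ]
    gcongr
    · exact hR1.le
    · omega
  have h2 : D ≤ c * R - c / 2 := by
    have := mul_le_mul_of_nonneg_left hR2 hc.le
    rw [mul_add, mul_div_cancel₀ _ hc.ne'] at this
    linarith
  have h3 : c * R - c / 2 ≤ R ^ N * (c * R - c / 2) := by
    refine le_mul_of_one_le_left ?_ hRN
    nlinarith
  have h4 : c / 2 * R ^ N ≤ (∫ y in Metric.closedBall 0 R, u y ^ p) - D := by nlinarith
  have h5 : c / 2 * R ^ N * Ψ (R / 2) ≤ T := by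
    refine le_trans ?_ hT
    rw [mul_comm]
    exact mul_le_mul_of_nonneg_left h4 hΨ0.le
  rw [div_lt_iff₀ (by positivity), div_pow] at hRT
  have h6 : R ^ N / 2 ^ N * Ψ (R / 2) * (c / 2 * 2 ^ N) = c / 2 * R ^ N * Ψ (R / 2) := by
    field_simp
  linarith

/-- When `p + q ≥ 2`, the a priori estimate makes fast growing masses blow up in finite radius. -/
theorem IsNonnegSolution.false_of_growth_of_two_le {N m k : ℕ} (hN : 1 ≤ N) (hm : 1 ≤ m)
    {Ψ : ℝ → ℝ} (hΨ : IsAdmissibleKernel N Ψ) {p q : ℝ} (hp : 0 < p) (hq : 0 < q)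
    (hpq : 2 ≤ p + q) {u : EuclideanSpace ℝ (Fin N) → ℝ} (hu : IsNonnegSolution m Ψ p q u)
    (hum : ∀ x, 0 ≤ polyLaplacian m u x) {c : ℝ} (hc : 0 < c)
    (hgrowth : ∀ᶠ R in atTop, c * R ^ (N + 2 * k) ≤ ∫ x in Metric.closedBall 0 R, u x)
    (hmean : ∀ᶠ R in atTop, volume.real (Metric.closedBall (0 : EuclideanSpace ℝ (Fin N)) (2 * R))
      ≤ ∫ x in Metric.closedBall 0 R, u x) : False := by
  obtain ⟨C, hC, hloc⟩ := exists_setIntegral_polyLaplacian_le hu.contDiff hu.nonneg hum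
  have huc := hu.contDiff.continuous
  have hint : ∀ R : ℝ, IntegrableOn u (Metric.closedBall 0 R) := fun R =>
    huc.continuousOn.integrableOn_compact (isCompact_closedBall _ _)
  have hmono : ∀ r s : ℝ, r ≤ s →
      ∫ x in Metric.closedBall 0 r, u x ≤ ∫ x in Metric.closedBall 0 s, u x := fun r s hrs =>
    setIntegral_mono_set (hint s) (Eventually.of_forall hu.nonneg)
      (Metric.closedBall_subset_closedBall hrs).eventuallyLE
  have htend : Tendsto (fun R : ℝ => (4 * R) ^ N * Ψ (4 * R)) atTop atTop :=
    hΨ.tendsto_atTop.comp (tendsto_id.const_mul_atTop (by norm_num : (0 : ℝ) < 4))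
  -- Halving the step `h` costs a factor `2 ^ (2 * m)` in the a priori estimate.
  set L : ℝ := 4 ^ m
  have hL : 1 < L := one_lt_pow₀ (by norm_num) (by omega)
  obtain ⟨R, hR1, hRg, hRm, hRΨ⟩ := ((eventually_ge_atTop 1).and (hgrowth.and (hmean.and
      (htend.eventually_ge_atTop (2 * L / (c / C / 6 ^ (2 * m) / 4 ^ N)))))).exists
  have hR0 : 0 < R := by linarith
  have hΨ0 : 0 < Ψ (4 * R) := hΨ.pos _ (by linarith)
  -- The increments `R / 2 ^ (n + 1)` equal `3 * h` for `h = R / 6 * (1 / 2) ^ n`. All radii stay in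
  -- `[R, 2 * R]`, so `Ψ (4 * R)` bounds every kernel factor below.
  let ρ : ℕ → ℝ := fun n => R * (2 - (1 / 2) ^ n)
  have hρ : ∀ n, R ≤ ρ n ∧ ρ n ≤ 2 * R := by
    intro n
    have h1 : (1 / 2 : ℝ) ^ n ≤ 1 := pow_le_one₀ (by norm_num) (by norm_num)
    have h2 : (0 : ℝ) < (1 / 2) ^ n := by positivity
    constructor <;> simp only [ρ] <;> nlinarith
  set K := (R / 6) ^ (2 * m) * Ψ (4 * R) / C
  have hK : 0 < K := by positivity
  refine not_bddAbove_of_sq_le (a := fun n => ∫ x in Metric.closedBall 0 (ρ n), u x) hK hL ?_ ?_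
    ⟨∫ x in Metric.closedBall 0 (2 * R), u x, ?_⟩
  · have e0 : ρ 0 = R := by simp only [ρ]; norm_num
    rw [e0]
    rw [div_le_iff₀ (by positivity)] at hRΨ
    calc 2 * L ≤ (4 * R) ^ N * Ψ (4 * R) * (c / C / 6 ^ (2 * m) / 4 ^ N) := hRΨ
      _ = Ψ (4 * R) / C / 6 ^ (2 * m) * (1 * (c * R ^ N)) := by
        rw [mul_pow]
        field_simp
      _ ≤ Ψ (4 * R) / C / 6 ^ (2 * m) * (R ^ (2 * m) * (c * R ^ (N + 2 * k))) := by
        gcongr ?_ * (?_ * (_ * ?_))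
        · exact one_le_pow₀ hR1
        · exact pow_le_pow_right₀ hR1 (by omega)
      _ = K * (c * R ^ (N + 2 * k)) := by
        simp only [K, div_pow]
        field_simp
      _ ≤ _ := by gcongr
  · intro n
    obtain ⟨h1, h2⟩ := hρ n
    have hρ0 : 0 < ρ n := hR0.trans_le h1
    -- `hmean` compares the doubled ball with the mass at radius `R`, so one choice of `R` serves
    -- every `ρ n`.
    have hV : volume.real (Metric.closedBall (0 : EuclideanSpace ℝ (Fin N)) (ρ n))
        ≤ ∫ x in Metric.closedBall 0 (ρ n), u x :=
      (measureReal_mono (Metric.closedBall_subset_closedBall h2)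
        (isCompact_closedBall _ _).measure_lt_top.ne).trans (hRm.trans (hmono _ _ h1))
    have h3 := hu.mul_sq_setIntegral_le hN hΨ hp hq hpq hρ0 hV
    have h4 := hloc (ρ n) (R / 6 * (1 / 2) ^ n) (by positivity)
    have e1 : ρ n + 3 * (R / 6 * (1 / 2) ^ n) = ρ (n + 1) := by
      simp only [ρ, pow_succ]
      ring
    rw [e1] at h4
    have h5 : Ψ (4 * R) ≤ Ψ (2 * ρ n) :=
      hΨ.antitoneOn (Set.mem_Ioi.2 (by linarith)) (Set.mem_Ioi.2 (by linarith)) (by linarith)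
    have e2 : (R / 6 * (1 / 2) ^ n) ^ (2 * m) = (R / 6) ^ (2 * m) / L ^ n := by
      have e3 : (1 / 2 : ℝ) ^ (2 * m) = 1 / L := by
        rw [pow_mul, div_pow, one_pow, div_pow, one_pow]
        norm_num [L]
      rw [mul_pow, ← pow_mul, mul_comm n, pow_mul (1 / 2 : ℝ), e3, one_div, inv_pow, ← div_eq_mul_inv]
    rw [e2] at h4
    have hLn : 0 < L ^ n := by positivity
    calc K * (∫ x in Metric.closedBall 0 (ρ n), u x) ^ 2
        = L ^ n / C * ((R / 6) ^ (2 * m) / L ^ n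
          * (Ψ (4 * R) * (∫ x in Metric.closedBall 0 (ρ n), u x) ^ 2)) := by
          simp only [K]
          field_simp
      _ ≤ L ^ n / C * ((R / 6) ^ (2 * m) / L ^ n
          * ∫ x in Metric.closedBall 0 (ρ n), polyLaplacian m u x) := by
          gcongr
          exact le_trans (by gcongr) h3
      _ ≤ L ^ n / C * (C * ∫ x in Metric.closedBall 0 (ρ (n + 1)), u x) := by gcongr
      _ = _ := by field_simp
  · rintro _ ⟨n, rfl⟩
    exact hmono _ _ (hρ n).2

/-- Volume grows only like `R ^ N`, and `k ≥ 1` leaves a spare power of `R`; hence growth of the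
mass forces the mean of `u` above `1`. -/
theorem eventually_measureReal_closedBall_le {N k : ℕ} (hk : 1 ≤ k) {c : ℝ} (hc : 0 < c) :
    ∀ᶠ R : ℝ in atTop, volume.real (Metric.closedBall (0 : EuclideanSpace ℝ (Fin N)) (2 * R))
      ≤ c * R ^ (N + 2 * k) := by
  set V := volume.real (Metric.ball (0 : EuclideanSpace ℝ (Fin N)) 1)
  filter_upwards [eventually_ge_atTop 1, eventually_ge_atTop (2 ^ N * V / c)] with R hR hRV
  have hR0 : 0 < R := by linarith
  rw [Measure.real, Measure.addHaar_closedBall volume _ (by positivity), ENNReal.toReal_mul,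
    ENNReal.toReal_ofReal (by positivity), finrank_euclideanSpace_fin, mul_pow]
  rw [div_le_iff₀ hc] at hRV
  calc 2 ^ N * R ^ N * V = R ^ N * (2 ^ N * V) := by ring
    _ ≤ R ^ N * (R * c) := by gcongr
    _ = c * R ^ (N + 1) := by ring
    _ ≤ c * R ^ (N + 2 * k) :=
      mul_le_mul_of_nonneg_left (pow_le_pow_right₀ hR (by omega)) hc.le

end

/-! ### Descent in the order -/

theorem theorem1p2 (N m : ℕ) (hN : 1 ≤ N) (hm : 1 ≤ m) (p q : ℝ) (hp : 0 < p) (hq : 0 < q)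
    (hpq : 2 ≤ p + q ∨ 1 ≤ p) (Ψ : ℝ → ℝ) (hΨ : IsAdmissibleKernel N Ψ)
    (u : EuclideanSpace ℝ (Fin N) → ℝ) (hu : IsNonnegSolution m Ψ p q u) :
    ∀ j : ℕ, 1 ≤ j → j ≤ m → ∀ x, 0 ≤ polyLaplacian j u x := by
  have hum : ∀ x, 0 ≤ polyLaplacian m u x := fun x =>
    (mul_nonneg (convPow_nonneg hN hΨ hu.nonneg x) (Real.rpow_nonneg (hu.nonneg x) q)).trans
      (hu.ineq x)
  intro j hj hjm
  induction hjm using Nat.decreasingInduction with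
  | self => exact hum
  | of_succ k hkm ih =>
    have hk := ih (by omega)
    by_contra! hneg
    obtain ⟨x₀, hx₀⟩ := hneg
    obtain ⟨c, hc, hgrowth⟩ := exists_le_setIntegral_ball_of_polyLaplacian_neg hN
      (hu.contDiff.of_le (by norm_cast; omega)) hu.nonneg hk hx₀
    -- Here the restriction to orders at least `1` enters: for order `0` the growth rate would be
    -- that of the volume itself.
    have hmean : ∀ᶠ R in atTop,
        volume.real (Metric.closedBall (0 : EuclideanSpace ℝ (Fin N)) (2 * R))
          ≤ ∫ x in Metric.closedBall 0 R, u x := by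
      filter_upwards [eventually_measureReal_closedBall_le hj hc, hgrowth] with R h1 h2
      exact h1.trans h2
    rcases hpq with hpq | hp1
    · exact hu.false_of_growth_of_two_le hN hm hΨ hp hq hpq hum hc hgrowth hmean
    · refine hu.false_of_growth_of_one_le hj hΨ hp1 hc hgrowth ?_
      filter_upwards [hmean, eventually_ge_atTop 0] with R h1 h2
      exact (measureReal_mono (Metric.closedBall_subset_closedBall (by linarith))
        (isCompact_closedBall _ _).measure_lt_top.ne).trans h1
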